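/- Throughout, $k$ is a non-zero commutative unital ring, and algebras are associative $k$-algebras, not necessarily unital. For an algebra $I$, a multiplier of $I$ is a pair $w=(R,L)$ of an endomorphism $x\mapsto xw:=xR$ of the left $I$-module $I$ and an endomorphism $x\mapsto wx:=Lx$ of the right $I$-module $I$ (both $k$-linear) with $(xw)y=x(wy)$ for all $x,y\in I$; the multipliers form a unital algebra $\mathcal M(I)$. Products of submodules denote all finite sums of products of elements. A twisted partial action $\Theta$ of a group $G$ on an algebra $\mathcal A$ consists of two-sided ideals $\mathcal D_g$ of $\mathcal A$, $k$-algebra isomorphisms $\theta_g:\mathcal D_{g^{-1}}\to\mathcal D_g$ $(g\in G)$ and invertible elements $w_{g,h}\in\mathcal M(\mathcal D_g\mathcal D_{gh})$ $(g,h\in G)$ such that for all $g,h,t\in G$: (i) $\mathcal D_g^2=\mathcal D_g$ and $\mathcal D_g\mathcal D_h=\mathcal D_h\mathcal D_g$; (ii) $\mathcal D_1=\mathcal A$ and $\theta_1=\mathrm{id}$; (iii) $\theta_g(\mathcal D_{g^{-1}}\mathcal D_h)=\mathcal D_g\mathcal D_{gh}$; (iv) $\theta_g(\theta_h(a))=w_{g,h}\,\theta_{gh}(a)\,w_{g,h}^{-1}$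 for $a\in\mathcal D_{h^{-1}}\mathcal D_{h^{-1}g^{-1}}$; (v) $w_{1,g}=w_{g,1}=1$; (vi) $\theta_g(a\,w_{h,t})\,w_{g,ht}=\theta_g(a)\,w_{g,h}\,w_{gh,t}$ for $a\in\mathcal D_{g^{-1}}\mathcal D_h\mathcal D_{ht}$. The crossed product $\mathcal A\rtimes_\Theta G$ is $\bigoplus_{g\in G}\mathcal D_g\delta_g$, graded by $G$ in the evident way, with multiplication $(a\delta_g)(b\delta_h)=\theta_g(\theta_g^{-1}(a)\,b)\,w_{g,h}\,\delta_{gh}$. For a non-zero cardinal $\gamma$, $\mathrm{FMat}_\gamma(\mathcal B)$ is the algebra of $\gamma\times\gamma$-matrices over $\mathcal B$ with only finitely many non-zero entries; if $\mathcal B=\bigoplus_{h\in G}\mathcal B_h$ is $G$-graded, its $h$-homogeneous component is $\mathrm{FMat}_\gamma(\mathcal B_h)$. **Statement.** Let $G$ be a group with an element $g$ such that $g^2\neq 1$. Then there is a $G$-graded $k$-algebra $\mathcal B=\bigoplus_{h\in G}\mathcal B_h$ such that 1. $\mathcal B$ is homogeneously non-degenerate: for all $h\in G$ and $0\neq x\in\mathcal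 B_h$ one has $x\,\mathcal B_{h^{-1}}\neq 0$ and $\mathcal B_{h^{-1}}x\neq 0$; 2. $\mathcal B_h\mathcal B_{h^{-1}}\mathcal B_h=\mathcal B_h$ for all $h\in G$; 3. for every $h\in G$ the ring $R=\mathcal B_h\mathcal B_{h^{-1}}$ has local units, i.e. every $r\in R$ lies in $eRe$ for some idempotent $e\in R$; 4. for every non-zero cardinal $\gamma$ and every twisted partial action $\Theta$ of $G$ on $\mathrm{FMat}_\gamma(\mathcal B_1)$, the graded algebras $\mathrm{FMat}_\gamma(\mathcal B)$ and $\mathrm{FMat}_\gamma(\mathcal B_1)\rtimes_\Theta G$ are not isomorphic as graded algebras. Remark (context, not part of the claim). It is a theorem that if 2 holds and every ring $R=\mathcal B_h\mathcal B_{h^{-1}}$ has orthogonal local units (a set $E$ of pairwise orthogonal idempotents with $R=\bigoplus_{e\in E}Re=\bigoplus_{e\in E}eR$), then $\mathrm{FMat}_\gamma(\mathcal B)$ is a crossed product as in 4 for some infinite $\gamma$; items 2–4 say that orthogonality cannot be dropped there. -/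

import Mathlib

/-! Throughout, `k` is a commutative unital ring and a `k`-algebra `A` is associative and not
necessarily unital: `[NonUnitalRing A] [Module k A] [IsScalarTower k A A] [SMulCommClass k A A]`. -/

namespace TwistedPartial

/-! ### Products of submodules and two-sided ideals -/

section Ideals

variable {k : Type*} {A : Type*} [CommRing k] [NonUnitalRing A] [Module k A]

/-- The product `M N`: all finite sums of elements `m * n` with `m ∈ M`, `n ∈ N`. -/
def mulSub (M N : Submodule k A) : Submodule k A :=
  Submodule.span k {x | ∃ m ∈ M, ∃ n ∈ N, m * n = x}

theorem mul_mem_mulSub {M N : Submodule k A} {m n : A} (hm : m ∈ M) (hn : n ∈ N) :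
    m * n ∈ mulSub M N :=
  Submodule.subset_span ⟨m, hm, n, hn, rfl⟩

theorem mulSub_le {M N P : Submodule k A} :
    mulSub M N ≤ P ↔ ∀ m ∈ M, ∀ n ∈ N, m * n ∈ P := by
  refine ⟨fun h m hm n hn => h (mul_mem_mulSub hm hn), fun h => Submodule.span_le.2 ?_⟩
  rintro _ ⟨m, hm, n, hn, rfl⟩
  exact h m hm n hn

variable (k A) in
/-- Two-sided ideals of the `k`-algebra `A`. -/
structure AlgIdeal extends Submodule k A where
  mul_mem_left' : ∀ (a : A) {x : A}, x ∈ carrier → a * x ∈ carrier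
  mul_mem_right' : ∀ (a : A) {x : A}, x ∈ carrier → x * a ∈ carrier

namespace AlgIdeal

theorem toSubmodule_injective :
    Function.Injective (AlgIdeal.toSubmodule : AlgIdeal k A → Submodule k A) := by
  rintro ⟨I, _, _⟩ ⟨J, _, _⟩ h
  cases h
  rfl

instance : SetLike (AlgIdeal k A) A where
  coe I := I.toSubmodule
  coe_injective _ _ h := toSubmodule_injective (SetLike.coe_injective h)

theorem mem_toSubmodule {I : AlgIdeal k A} {x : A} : x ∈ I.toSubmodule ↔ x ∈ I := Iff.rfl

theorem mul_mem_left (I : AlgIdeal k A) (a : A) {x : A} (hx : x ∈ I) : a * x ∈ I :=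
  I.mul_mem_left' a hx

theorem mul_mem_right (I : AlgIdeal k A) (a : A) {x : A} (hx : x ∈ I) : x * a ∈ I :=
  I.mul_mem_right' a hx

instance : NonUnitalSubringClass (AlgIdeal k A) A where
  add_mem {I} _ _ ha hb := I.toSubmodule.add_mem ha hb
  zero_mem I := I.toSubmodule.zero_mem
  neg_mem {I} _ ha := I.toSubmodule.neg_mem ha
  mul_mem {I} a _ _ hb := I.mul_mem_left a hb

instance : SMulMemClass (AlgIdeal k A) k A where
  smul_mem {I} c _ hx := I.toSubmodule.smul_mem c hx

instance : Top (AlgIdeal k A) :=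
  ⟨{ (⊤ : Submodule k A) with
      mul_mem_left' := fun _ _ _ => trivial
      mul_mem_right' := fun _ _ _ => trivial }⟩

variable [IsScalarTower k A A] [SMulCommClass k A A]

/-- The product of two ideals. -/
instance : Mul (AlgIdeal k A) :=
  ⟨fun I J =>
    { mulSub I.toSubmodule J.toSubmodule with
      mul_mem_left' := by
        intro a x hx
        have h : mulSub I.toSubmodule J.toSubmodule ≤
            (mulSub I.toSubmodule J.toSubmodule).comap (LinearMap.mulLeft k a) := by
          refine mulSub_le.2 fun m hm n hn => ?_
          simp only [Submodule.mem_comap, LinearMap.mulLeft_apply, ← mul_assoc]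
          exact mul_mem_mulSub (I.mul_mem_left a hm) hn
        exact h hx
      mul_mem_right' := by
        intro a x hx
        have h : mulSub I.toSubmodule J.toSubmodule ≤
            (mulSub I.toSubmodule J.toSubmodule).comap (LinearMap.mulRight k a) := by
          refine mulSub_le.2 fun m hm n hn => ?_
          simp only [Submodule.mem_comap, LinearMap.mulRight_apply, mul_assoc]
          exact mul_mem_mulSub hm (J.mul_mem_right a hn)
        exact h hx }⟩

theorem toSubmodule_mul (I J : AlgIdeal k A) :
    (I * J).toSubmodule = mulSub I.toSubmodule J.toSubmodule := rfl

theorem mul_mem_mul {I J : AlgIdeal k A} {x y : A} (hx : x ∈ I) (hy : y ∈ J) : x * y ∈ I * J :=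
  mul_mem_mulSub (M := I.toSubmodule) (N := J.toSubmodule) hx hy

theorem mul_le_iff {I J : AlgIdeal k A} {P : Submodule k A} :
    (∀ x ∈ I * J, x ∈ P) ↔ ∀ x ∈ I, ∀ y ∈ J, x * y ∈ P :=
  mulSub_le (M := I.toSubmodule) (N := J.toSubmodule)

theorem mem_left_of_mem_mul {I J : AlgIdeal k A} {x : A} (hx : x ∈ I * J) : x ∈ I :=
  mul_le_iff (P := I.toSubmodule).2 (fun _ ha b _ => I.mul_mem_right b ha) x hx

theorem mem_right_of_mem_mul {I J : AlgIdeal k A} {x : A} (hx : x ∈ I * J) : x ∈ J :=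
  mul_le_iff (P := J.toSubmodule).2 (fun a _ _ hb => J.mul_mem_left a hb) x hx

theorem mul_mono {I I' J J' : AlgIdeal k A} (hI : ∀ x ∈ I, x ∈ I') (hJ : ∀ x ∈ J, x ∈ J')
    {x : A} (hx : x ∈ I * J) : x ∈ I' * J' :=
  mul_le_iff (P := (I' * J').toSubmodule).2
    (fun a ha b hb => mul_mem_mul (hI a ha) (hJ b hb)) x hx

protected theorem mul_assoc (I J K : AlgIdeal k A) : I * J * K = I * (J * K) := by
  refine SetLike.ext fun x => ⟨fun hx => ?_, fun hx => ?_⟩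
  · refine mul_le_iff (P := (I * (J * K)).toSubmodule).2 (fun a ha c hc => ?_) x hx
    refine mul_le_iff (P := ((I * (J * K)).toSubmodule).comap (LinearMap.mulRight k c)).2
      (fun i hi j hj => ?_) a ha
    simp only [Submodule.mem_comap, LinearMap.mulRight_apply, mul_assoc]
    exact mul_mem_mul hi (mul_mem_mul hj hc)
  · refine mul_le_iff (P := (I * J * K).toSubmodule).2 (fun i hi a ha => ?_) x hx
    refine mul_le_iff (P := ((I * J * K).toSubmodule).comap (LinearMap.mulLeft k i)).2
      (fun j hj c hc => ?_) a ha
    simp only [Submodule.mem_comap, LinearMap.mulLeft_apply, ← mul_assoc]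
    exact mul_mem_mul (mul_mem_mul hi hj) hc

theorem mul_comm_of {G : Type*} {D : G → AlgIdeal k A} (hD : ∀ g h, D g * D h = D h * D g)
    (a b c : G) : D a * D b * D c = D c * (D a * D b) := by
  rw [AlgIdeal.mul_assoc, hD b c, ← AlgIdeal.mul_assoc, hD a c, AlgIdeal.mul_assoc]

end AlgIdeal

end Ideals

/-! ### Multipliers -/

/-- A multiplier of the `k`-algebra `I`: a pair of a right multiplier `x ↦ x R` (an endomorphism of
the left `I`-module `I`, here the function `right`) and a left multiplier `x ↦ L x` (an
endomorphism of the right `I`-module `I`, here the function `left`) with `(x R) y = x (L y)`. -/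
@[ext]
structure Multiplier (k : Type*) (I : Type*) [CommRing k] [NonUnitalRing I] [Module k I] where
  right : I →ₗ[k] I
  left : I →ₗ[k] I
  right_mul : ∀ x y, right (x * y) = x * right y
  left_mul : ∀ x y, left (x * y) = left x * y
  compat : ∀ x y, right x * y = x * left y

namespace Multiplier

variable {k : Type*} {I : Type*} [CommRing k] [NonUnitalRing I] [Module k I]

/-- The multiplicative monoid of the multiplier algebra: `x (w w') = (x w) w'` and
`(w w') x = w (w' x)`. -/
instance : Monoid (Multiplier k I) where
  one := ⟨LinearMap.id, LinearMap.id, fun _ _ => rfl, fun _ _ => rfl, fun _ _ => rfl⟩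
  mul m n :=
    ⟨n.right ∘ₗ m.right, m.left ∘ₗ n.left,
      fun x y => by simp [right_mul], fun x y => by simp [left_mul],
      fun x y => by simp [compat]⟩
  mul_assoc _ _ _ := rfl
  one_mul _ := rfl
  mul_one _ := rfl

/-- A right multiplier of an idempotent ideal `I` maps `J I` into itself. -/
theorem right_mem {A : Type*} [NonUnitalRing A] [Module k A] [IsScalarTower k A A]
    [SMulCommClass k A A] {I J : AlgIdeal k A} (hI : I * I = I) (m : Multiplier k I) {x : I}
    (hx : (x : A) ∈ J * I) : (m.right x : A) ∈ J * I := by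
  let P : Submodule k A :=
    (((J * I).toSubmodule.comap I.toSubmodule.subtype).comap m.right).map I.toSubmodule.subtype
  have hP : (x : A) ∈ P := by
    have hx' : (x : A) ∈ (J * I) * I := by rwa [AlgIdeal.mul_assoc, hI]
    refine AlgIdeal.mul_le_iff (P := P).2 (fun a ha b hb => ?_) x hx'
    have ha' := AlgIdeal.mem_right_of_mem_mul ha
    refine ⟨(⟨a, ha'⟩ : I) * ⟨b, hb⟩, ?_, rfl⟩
    change ((m.right (⟨a, ha'⟩ * ⟨b, hb⟩) : I) : A) ∈ J * I
    rw [m.right_mul]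
    exact (J * I).mul_mem_right _ ha
  obtain ⟨z, hz, hzx⟩ := hP
  have hzx' : z = x := Subtype.ext hzx
  subst hzx'
  exact hz

end Multiplier

/-! ### Twisted partial actions -/

section Actions

variable (k : Type*) (G : Type*) (A : Type*) [CommRing k] [Group G] [NonUnitalRing A] [Module k A]
  [IsScalarTower k A A] [SMulCommClass k A A]

/-- The ideals `D g` and isomorphisms `θ g` of a twisted partial action, with those postulates
that do not involve the twisting. -/
structure PartialDatum where
  D : G → AlgIdeal k A
  θ : ∀ g : G, D g⁻¹ ≃ₗ[k] D g
  θ_mul : ∀ (g : G) (x y : D g⁻¹), θ g (x * y) = θ g x * θ g y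
  D_idem : ∀ g, D g * D g = D g
  D_comm : ∀ g h, D g * D h = D h * D g
  D_one : D 1 = ⊤
  θ_one : ∀ x : D (1 : G)⁻¹, (θ 1 x : A) = x
  θ_image : ∀ g h : G,
    {a : A | ∃ x : D g⁻¹, (x : A) ∈ D g⁻¹ * D h ∧ (θ g x : A) = a} =
      {a : A | a ∈ D g * D (g * h)}

variable {k G A}

namespace PartialDatum

variable (Θ : PartialDatum k G A)

theorem θ_mem {g h : G} {x : Θ.D g⁻¹} (hx : (x : A) ∈ Θ.D g⁻¹ * Θ.D h) :
    (Θ.θ g x : A) ∈ Θ.D g * Θ.D (g * h) := by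
  have h' : (Θ.θ g x : A) ∈ {a : A | a ∈ Θ.D g * Θ.D (g * h)} := by
    rw [← Θ.θ_image g h]
    exact ⟨x, hx, rfl⟩
  exact h'

/-- `θ g` as a map from `D g⁻¹ D h` to `D g D (g h)`. -/
def θres (g h : G) (x : A) (hx : x ∈ Θ.D g⁻¹ * Θ.D h) : ↥(Θ.D g * Θ.D (g * h)) :=
  ⟨Θ.θ g ⟨x, AlgIdeal.mem_left_of_mem_mul hx⟩, Θ.θ_mem hx⟩

theorem θres_add {g h : G} {x y : A} (hx : x ∈ Θ.D g⁻¹ * Θ.D h) (hy : y ∈ Θ.D g⁻¹ * Θ.D h) :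
    Θ.θres g h (x + y) (add_mem hx hy) = Θ.θres g h x hx + Θ.θres g h y hy :=
  Subtype.ext (congrArg (Subtype.val : Θ.D g → A) (map_add (Θ.θ g)
    ⟨x, AlgIdeal.mem_left_of_mem_mul hx⟩ ⟨y, AlgIdeal.mem_left_of_mem_mul hy⟩))

theorem θres_smul {g h : G} (c : k) {x : A} (hx : x ∈ Θ.D g⁻¹ * Θ.D h) :
    Θ.θres g h (c • x) (SMulMemClass.smul_mem c hx) = c • Θ.θres g h x hx :=
  Subtype.ext (congrArg (Subtype.val : Θ.D g → A) (map_smul (Θ.θ g) c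
    ⟨x, AlgIdeal.mem_left_of_mem_mul hx⟩))

theorem mul_idem (g h : G) :
    (Θ.D g * Θ.D h) * (Θ.D g * Θ.D h) = Θ.D g * Θ.D h := by
  rw [AlgIdeal.mul_assoc, ← AlgIdeal.mul_assoc (Θ.D h), Θ.D_comm h g, AlgIdeal.mul_assoc,
    Θ.D_idem, ← AlgIdeal.mul_assoc, Θ.D_idem]

theorem mul_three (g h t : G) :
    Θ.D g * (Θ.D h * Θ.D t) = (Θ.D g * Θ.D h) * (Θ.D g * Θ.D t) := by
  conv_lhs => rw [← Θ.D_idem g]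
  rw [AlgIdeal.mul_assoc, AlgIdeal.mul_assoc, ← AlgIdeal.mul_assoc (Θ.D g) (Θ.D h),
    Θ.D_comm g h, AlgIdeal.mul_assoc]

theorem θ_mem_three {g h t : G} {x : Θ.D g⁻¹}
    (hx : (x : A) ∈ Θ.D g⁻¹ * (Θ.D h * Θ.D t)) :
    (Θ.θ g x : A) ∈ Θ.D g * (Θ.D (g * h) * Θ.D (g * t)) := by
  rw [mul_three] at hx ⊢
  let P : Submodule k A :=
    ((((Θ.D g * Θ.D (g * h)) * (Θ.D g * Θ.D (g * t))).toSubmodule.comap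
      (Θ.D g).toSubmodule.subtype).comap (Θ.θ g).toLinearMap).map
        (Θ.D g⁻¹).toSubmodule.subtype
  have hP : (x : A) ∈ P := by
    refine AlgIdeal.mul_le_iff (P := P).2 (fun a ha b hb => ?_) x hx
    have ha' := AlgIdeal.mem_left_of_mem_mul ha
    have hb' := AlgIdeal.mem_left_of_mem_mul hb
    refine ⟨(⟨a, ha'⟩ : Θ.D g⁻¹) * ⟨b, hb'⟩, ?_, rfl⟩
    change ((Θ.θ g (⟨a, ha'⟩ * ⟨b, hb'⟩) : Θ.D g) : A) ∈
      (Θ.D g * Θ.D (g * h)) * (Θ.D g * Θ.D (g * t))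
    rw [Θ.θ_mul]
    exact AlgIdeal.mul_mem_mul (Θ.θ_mem (x := ⟨a, ha'⟩) ha) (Θ.θ_mem (x := ⟨b, hb'⟩) hb)
  obtain ⟨z, hz, hzx⟩ := hP
  have hzx' : z = x := Subtype.ext hzx
  subst hzx'
  exact hz

theorem mem_iv₁ {g h : G} {a : A} (ha : a ∈ Θ.D h⁻¹ * Θ.D (g * h)⁻¹) :
    (Θ.θ h ⟨a, AlgIdeal.mem_left_of_mem_mul ha⟩ : A) ∈ Θ.D g⁻¹ := by
  have h1 := AlgIdeal.mem_right_of_mem_mul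
    (Θ.θ_mem (x := ⟨a, AlgIdeal.mem_left_of_mem_mul ha⟩) ha)
  have h2 : h * (g * h)⁻¹ = g⁻¹ := by group
  rwa [h2] at h1

theorem mem_iv₂ {g h : G} {a : A} (ha : a ∈ Θ.D h⁻¹ * Θ.D (g * h)⁻¹) :
    (Θ.θ (g * h) ⟨a, AlgIdeal.mem_right_of_mem_mul ha⟩ : A) ∈ Θ.D g * Θ.D (g * h) := by
  have h1 := Θ.θ_mem (g := g * h) (h := h⁻¹) (x := ⟨a, AlgIdeal.mem_right_of_mem_mul ha⟩)
    (by rw [Θ.D_comm]; exact ha)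
  rwa [mul_inv_cancel_right, Θ.D_comm] at h1

theorem mem_vi₁ {g h t : G} {a : A} (ha : a ∈ Θ.D g⁻¹ * (Θ.D h * Θ.D (h * t)))
    (m : Multiplier k ↥(Θ.D h * Θ.D (h * t))) :
    (m.right ⟨a, AlgIdeal.mem_right_of_mem_mul ha⟩ : A) ∈ Θ.D g⁻¹ * Θ.D (h * t) :=
  AlgIdeal.mul_mono (fun _ h => h) (fun _ h => AlgIdeal.mem_right_of_mem_mul h)
    (Multiplier.right_mem (Θ.mul_idem h (h * t)) m
      (x := ⟨a, AlgIdeal.mem_right_of_mem_mul ha⟩) ha)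

theorem mem_vi₂ {g h t : G} {a : A} (ha : a ∈ Θ.D g⁻¹ * (Θ.D h * Θ.D (h * t))) :
    a ∈ Θ.D g⁻¹ * Θ.D h :=
  AlgIdeal.mul_mono (fun _ h => h) (fun _ h => AlgIdeal.mem_left_of_mem_mul h) ha

theorem mem_vi₃ {g h t : G} {a : A} (ha : a ∈ Θ.D g⁻¹ * (Θ.D h * Θ.D (h * t)))
    (m : Multiplier k ↥(Θ.D g * Θ.D (g * h))) :
    (m.right (Θ.θres g h a (Θ.mem_vi₂ ha)) : A) ∈ Θ.D (g * h) * Θ.D (g * h * t) := by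
  have h1 : (Θ.θ g ⟨a, AlgIdeal.mem_left_of_mem_mul ha⟩ : A) ∈
      Θ.D (g * h * t) * (Θ.D g * Θ.D (g * h)) := by
    have h2 := Θ.θ_mem_three (x := ⟨a, AlgIdeal.mem_left_of_mem_mul ha⟩) ha
    rwa [← mul_assoc g h t, ← AlgIdeal.mul_assoc,
      AlgIdeal.mul_comm_of Θ.D_comm g (g * h) (g * h * t)] at h2
  rw [Θ.D_comm]
  exact AlgIdeal.mul_mono (fun _ h => h) (fun _ h => AlgIdeal.mem_right_of_mem_mul h)
    (Multiplier.right_mem (Θ.mul_idem g (g * h)) m (x := Θ.θres g h a (Θ.mem_vi₂ ha)) h1)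

end PartialDatum

variable (k G A) in
/-- A twisted partial action of `G` on `A`: in addition to the ideals and isomorphisms, invertible
multipliers `w g h` of `D g D (g h)` such that

* `θ g (θ h a) = w g h · θ (g h) a · (w g h)⁻¹` for `a ∈ D h⁻¹ D (g h)⁻¹`;
* `w 1 g = 1 = w g 1`;
* `θ g (a · w h t) · w g (h t) = θ g a · w g h · w (g h) t` for `a ∈ D g⁻¹ D h D (h t)`. -/
structure TwistedPartialAction extends PartialDatum k G A where
  w : ∀ g h : G, (Multiplier k ↥(D g * D (g * h)))ˣ
  θ_comp : ∀ (g h : G) (a : A) (ha : a ∈ D h⁻¹ * D (g * h)⁻¹),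
    (θ g ⟨θ h ⟨a, AlgIdeal.mem_left_of_mem_mul ha⟩, toPartialDatum.mem_iv₁ ha⟩ : A) =
      (w g h)⁻¹.val.right ((w g h).val.left
        ⟨θ (g * h) ⟨a, AlgIdeal.mem_right_of_mem_mul ha⟩, toPartialDatum.mem_iv₂ ha⟩)
  w_one_left : ∀ g : G, w 1 g = 1
  w_one_right : ∀ g : G, w g 1 = 1
  cocycle : ∀ (g h t : G) (a : A) (ha : a ∈ D g⁻¹ * (D h * D (h * t))),
    ((w g (h * t)).val.right (toPartialDatum.θres g (h * t)
        ((w h t).val.right ⟨a, AlgIdeal.mem_right_of_mem_mul ha⟩)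
        (toPartialDatum.mem_vi₁ ha (w h t).val)) : A) =
      (w (g * h) t).val.right
        ⟨(w g h).val.right (toPartialDatum.θres g h a (toPartialDatum.mem_vi₂ ha)),
          toPartialDatum.mem_vi₃ ha (w g h).val⟩

/-! ### Crossed products -/

namespace TwistedPartialAction

variable (Θ : TwistedPartialAction k G A)

/-- The underlying module `⨁ g, D g δ_g` of the crossed product. -/
def CrossedProduct : Type _ := DirectSum G fun g => ↥(Θ.D g)

noncomputable instance : AddCommGroup Θ.CrossedProduct :=
  inferInstanceAs (AddCommGroup (DirectSum G fun g => ↥(Θ.D g)))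

noncomputable instance : Module k Θ.CrossedProduct :=
  inferInstanceAs (Module k (DirectSum G fun g => ↥(Θ.D g)))

open Classical in
/-- The map `a ↦ a δ_g` from `D g` to the crossed product. -/
noncomputable def δ (g : G) : Θ.D g →ₗ[k] Θ.CrossedProduct :=
  DirectSum.lof k G (fun g => ↥(Θ.D g)) g

theorem coeff_mem {g h : G} (a : Θ.D g) (b : Θ.D h) :
    ((Θ.θ g).symm a : A) * b ∈ Θ.D g⁻¹ * Θ.D h :=
  AlgIdeal.mul_mem_mul ((Θ.θ g).symm a).2 b.2

/-- The coefficient `θ g (θ g ⁻¹ (a) b) w g h` of `(a δ_g) (b δ_h)`. -/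
def coeff (g h : G) (a : Θ.D g) (b : Θ.D h) : Θ.D (g * h) :=
  ⟨(Θ.w g h).val.right (Θ.θres g h ((Θ.θ g).symm a * b) (Θ.coeff_mem a b)),
    AlgIdeal.mem_right_of_mem_mul (SetLike.coe_mem _)⟩

theorem coeff_of_eq {g h : G} {a : Θ.D g} {b : Θ.D h} {x : A} (hx : x ∈ Θ.D g⁻¹ * Θ.D h)
    (e : ((Θ.θ g).symm a : A) * b = x) :
    (Θ.coeff g h a b : A) = (Θ.w g h).val.right (Θ.θres g h x hx) := by
  subst e
  rfl

/-- `coeff` as a bilinear map. -/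
def coeffₗ (g h : G) : Θ.D g →ₗ[k] Θ.D h →ₗ[k] Θ.D (g * h) :=
  LinearMap.mk₂ k (Θ.coeff g h)
    (fun a a' b => Subtype.ext <| by
      rw [Θ.coeff_of_eq (add_mem (Θ.coeff_mem a b) (Θ.coeff_mem a' b)) (by simp [add_mul]),
        PartialDatum.θres_add, map_add]
      rfl)
    (fun c a b => Subtype.ext <| by
      rw [Θ.coeff_of_eq (SMulMemClass.smul_mem c (Θ.coeff_mem a b))
        (by simp [smul_mul_assoc]), PartialDatum.θres_smul, map_smul]
      rfl)
    (fun a b b' => Subtype.ext <| by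
      rw [Θ.coeff_of_eq (add_mem (Θ.coeff_mem a b) (Θ.coeff_mem a b')) (by simp [mul_add]),
        PartialDatum.θres_add, map_add]
      rfl)
    (fun c a b => Subtype.ext <| by
      rw [Θ.coeff_of_eq (SMulMemClass.smul_mem c (Θ.coeff_mem a b))
        (by simp [mul_smul_comm]), PartialDatum.θres_smul, map_smul]
      rfl)

open Classical in
/-- The linear map on the crossed product given by linear maps on the summands. -/
noncomputable def lift {N : Type*} [AddCommGroup N] [Module k N] (φ : ∀ g, Θ.D g →ₗ[k] N) :
    Θ.CrossedProduct →ₗ[k] N :=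
  DirectSum.toModule k G N φ

theorem lift_δ {N : Type*} [AddCommGroup N] [Module k N] (φ : ∀ g, Θ.D g →ₗ[k] N) (g : G)
    (x : Θ.D g) : Θ.lift φ (Θ.δ g x) = φ g x := by
  classical
  exact DirectSum.toModule_lof (M := fun g => ↥(Θ.D g)) (φ := φ) k g x

/-- The multiplication of the crossed product, the bilinear extension of
`(a δ_g) (b δ_h) = θ g (θ g ⁻¹ (a) b) w g h δ_{g h}`. -/
noncomputable def mulₗ : Θ.CrossedProduct →ₗ[k] Θ.CrossedProduct →ₗ[k] Θ.CrossedProduct :=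
  Θ.lift fun g => (Θ.lift fun h => ((Θ.coeffₗ g h).compr₂ (Θ.δ (g * h))).flip).flip

noncomputable instance : NonUnitalNonAssocRing Θ.CrossedProduct :=
  { (inferInstance : AddCommGroup Θ.CrossedProduct) with
    mul := fun x y => Θ.mulₗ x y
    left_distrib := fun x y z => map_add (Θ.mulₗ x) y z
    right_distrib := fun x y z => LinearMap.map_add₂ Θ.mulₗ x y z
    zero_mul := fun x => LinearMap.map_zero₂ Θ.mulₗ x
    mul_zero := fun x => map_zero (Θ.mulₗ x) }

theorem δ_mul_δ (g h : G) (a : Θ.D g) (b : Θ.D h) :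
    Θ.δ g a * Θ.δ h b = Θ.δ (g * h) (Θ.coeff g h a b) := by
  change Θ.mulₗ (Θ.δ g a) (Θ.δ h b) = _
  rw [mulₗ, lift_δ, LinearMap.flip_apply, lift_δ]
  rfl

/-- The homogeneous component `D g δ_g` of the crossed product. -/
noncomputable def component (g : G) : Submodule k Θ.CrossedProduct :=
  LinearMap.range (Θ.δ g)

end TwistedPartialAction

end Actions

/-! ### Graded algebras -/

section Graded

variable (k : Type*) (G : Type*) (B : Type*) [CommRing k] [Group G] [NonUnitalRing B] [Module k B]

open Classical in
/-- A `G`-grading of the algebra `B`: `B` is the internal direct sum of the submodules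
`component g`, and `component g * component h ⊆ component (g h)`. -/
structure Grading where
  component : G → Submodule k B
  isInternal : DirectSum.IsInternal component
  mul_mem : ∀ {g h : G} {x y : B}, x ∈ component g → y ∈ component h → x * y ∈ component (g * h)

variable {k G B}

namespace Grading

variable (𝓑 : Grading k G B)

/-- The algebra `B₁`, the homogeneous component of the identity of `G`. -/
def unitComponent : NonUnitalSubalgebra k B :=
  { 𝓑.component 1 with
    mul_mem' := fun hx hy => by simpa using 𝓑.mul_mem hx hy }

/-- Homogeneous non-degeneracy: `x B_{g⁻¹} ≠ 0` and `B_{g⁻¹} x ≠ 0` for `0 ≠ x ∈ B_g`. -/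
def HomogeneouslyNondegenerate : Prop :=
  ∀ (g : G), ∀ x ∈ 𝓑.component g, x ≠ 0 →
    (∃ y ∈ 𝓑.component g⁻¹, x * y ≠ 0) ∧ (∃ y ∈ 𝓑.component g⁻¹, y * x ≠ 0)

/-- `𝓓_g = B_g B_{g⁻¹}`. -/
def dom (g : G) : Submodule k B := mulSub (𝓑.component g) (𝓑.component g⁻¹)

end Grading

/-- The subring `R` of `B` has local units: each `r ∈ R` lies in `e R e` for an idempotent
`e ∈ R`. -/
def HasLocalUnits (R : Submodule k B) : Prop :=
  ∀ r ∈ R, ∃ e ∈ R, e * e = e ∧ ∃ s ∈ R, r = e * s * e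

/-- Two `k`-algebras with families of homogeneous components indexed by `G` are isomorphic as
graded algebras. -/
def GradedIsomorphic {B C : Type*} [NonUnitalNonAssocRing B] [Module k B]
    [NonUnitalNonAssocRing C] [Module k C] (𝓑 : G → Submodule k B) (𝓒 : G → Submodule k C) :
    Prop :=
  ∃ e : B ≃ₗ[k] C, (∀ x y, e (x * y) = e x * e y) ∧
    ∀ g, (𝓑 g).map (e : B →ₗ[k] C) = 𝓒 g

end Graded

/-! ### Matrices with finitely many non-zero entries -/

/-- The set `FMat_X(B)` of `X × X`-matrices over `B` with finitely many non-zero entries; the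
`(i, j)`-entry of `M` is `M (i, j)`. -/
def FMat (X : Type*) (B : Type*) [Zero B] : Type _ := (X × X) →₀ B

namespace FMat

variable {X B : Type*}

instance [Zero B] : CoeFun (FMat X B) fun _ => X × X → B :=
  inferInstanceAs (CoeFun ((X × X) →₀ B) fun _ => X × X → B)

noncomputable instance [NonUnitalRing B] : AddCommGroup (FMat X B) :=
  inferInstanceAs (AddCommGroup ((X × X) →₀ B))

noncomputable instance {k : Type*} [CommRing k] [NonUnitalRing B] [Module k B] :
    Module k (FMat X B) :=
  inferInstanceAs (Module k ((X × X) →₀ B))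

section Ring

variable [NonUnitalRing B]

theorem exists_ne_zero {f : X → B} (h : ∑ᶠ l, f l ≠ 0) : ∃ l, f l ≠ 0 := by
  by_contra! h'
  exact h (finsum_eq_zero_of_forall_eq_zero h')

theorem finite_support (M N : FMat X B) (i j : X) :
    (Function.support fun l => M (i, l) * N (l, j)).Finite := by
  refine ((Finsupp.hasFiniteSupport (M : (X × X) →₀ B)).image Prod.snd).subset fun l hl => ?_
  exact ⟨(i, l), fun h => hl (by change M (i, l) * N (l, j) = 0; rw [show M (i, l) = 0 from h,
    zero_mul]), rfl⟩

/-- Matrix multiplication `(M N)(i, j) = ∑ l, M(i, l) N(l, j)`, a finite sum. -/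
noncomputable instance : Mul (FMat X B) :=
  ⟨fun M N => Finsupp.ofSupportFinite (fun p => ∑ᶠ l, M (p.1, l) * N (l, p.2)) (by
    refine (((Finsupp.hasFiniteSupport (M : (X × X) →₀ B)).image Prod.fst).prod
      ((Finsupp.hasFiniteSupport (N : (X × X) →₀ B)).image Prod.snd)).subset fun p hp => ?_
    obtain ⟨l, hl⟩ := exists_ne_zero hp
    exact ⟨⟨(p.1, l), left_ne_zero_of_mul hl, rfl⟩, ⟨(l, p.2), right_ne_zero_of_mul hl, rfl⟩⟩)⟩

@[ext]
theorem ext {M N : FMat X B} (h : ∀ i j, M (i, j) = N (i, j)) : M = N :=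
  Finsupp.ext fun p => h p.1 p.2

theorem mul_apply (M N : FMat X B) (i j : X) :
    (M * N) (i, j) = ∑ᶠ l, M (i, l) * N (l, j) := rfl

theorem add_apply (M N : FMat X B) (p : X × X) : (M + N) p = M p + N p := rfl

theorem zero_apply (p : X × X) : (0 : FMat X B) p = 0 := rfl

theorem smul_apply {k : Type*} [CommRing k] [Module k B] (c : k) (M : FMat X B) (p : X × X) :
    (c • M) p = c • M p := rfl

noncomputable instance : NonUnitalRing (FMat X B) :=
  { (inferInstance : AddCommGroup (FMat X B)), (inferInstance : Mul (FMat X B)) with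
    left_distrib := fun M N P => by
      ext i j
      simp only [mul_apply, add_apply, mul_add]
      exact finsum_add_distrib (finite_support M N i j) (finite_support M P i j)
    right_distrib := fun M N P => by
      ext i j
      simp only [mul_apply, add_apply, add_mul]
      exact finsum_add_distrib (finite_support M P i j) (finite_support N P i j)
    zero_mul := fun M => by
      ext i j
      simp [mul_apply, zero_apply]
    mul_zero := fun M => by
      ext i j
      simp [mul_apply, zero_apply]
    mul_assoc := fun M N P => by
      classical
      ext i j
      simp only [mul_apply]
      have hs : ∀ (Q R : FMat X B) (a b : X) (s : Finset X),
          (∀ l, Q (a, l) ≠ 0 → l ∈ s) →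
          ∑ᶠ l, Q (a, l) * R (l, b) = ∑ l ∈ s, Q (a, l) * R (l, b) := fun Q R a b s h =>
        finsum_eq_sum_of_support_subset _ fun l hl => h l (left_ne_zero_of_mul hl)
      let s : Finset X := (Finsupp.support (M : (X × X) →₀ B)).image Prod.snd
      let t : Finset X := (Finsupp.support (N : (X × X) →₀ B)).image Prod.snd
      have hM : ∀ a l, M (a, l) ≠ 0 → l ∈ s := fun a l h =>
        Finset.mem_image.2 ⟨(a, l), Finsupp.mem_support_iff.2 h, rfl⟩
      have hN : ∀ a l, N (a, l) ≠ 0 → l ∈ t := fun a l h =>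
        Finset.mem_image.2 ⟨(a, l), Finsupp.mem_support_iff.2 h, rfl⟩
      have hMN : ∀ l, (M * N) (i, l) ≠ 0 → l ∈ t := fun l h => by
        obtain ⟨m, hm⟩ := exists_ne_zero h
        exact hN m l (right_ne_zero_of_mul hm)
      have h1 : ∑ᶠ l, (∑ᶠ m, M (i, m) * N (m, l)) * P (l, j) =
          ∑ l ∈ t, (∑ᶠ m, M (i, m) * N (m, l)) * P (l, j) := hs (M * N) P i j t hMN
      have h2 : ∑ᶠ l, M (i, l) * (∑ᶠ m, N (l, m) * P (m, j)) =
          ∑ l ∈ s, M (i, l) * (∑ᶠ m, N (l, m) * P (m, j)) := hs M (N * P) i j s (hM i)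
      rw [h1, h2]
      simp only [hs M N i _ s (hM i), hs N P _ j t (hN _), Finset.sum_mul, Finset.mul_sum,
        mul_assoc]
      exact Finset.sum_comm }

variable {k : Type*} [CommRing k] [Module k B]

instance [IsScalarTower k B B] : IsScalarTower k (FMat X B) (FMat X B) where
  smul_assoc c M N := by
    ext i j
    simp only [smul_eq_mul, mul_apply, smul_apply, smul_mul_assoc]
    exact (smul_finsum' c (finite_support M N i j)).symm

instance [SMulCommClass k B B] : SMulCommClass k (FMat X B) (FMat X B) where
  smul_comm c M N := by
    ext i j
    simp only [smul_eq_mul, mul_apply, smul_apply, mul_smul_comm]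
    exact smul_finsum' c (finite_support M N i j)

/-- The submodule `FMat_X(S)` of `FMat_X(B)` for a submodule `S` of `B`. -/
def submodule (X : Type*) (S : Submodule k B) : Submodule k (FMat X B) where
  carrier := {M | ∀ i j, M (i, j) ∈ S}
  add_mem' hM hN i j := S.add_mem (hM i j) (hN i j)
  zero_mem' _ _ := S.zero_mem
  smul_mem' c _ hM i j := S.smul_mem c (hM i j)

end Ring

end FMat

end TwistedPartial

universe u v w

/-! In a crossed product `a δ_1 ↦ a δ_g` is an injection of `D g δ_1` into the component of degree
`g` that is left linear over the component of degree `1`. Hence a graded isomorphism of `FMat_X(B)`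
with any crossed product whatsoever gives such an injection `ψ` on
`FMat_X(B_g) FMat_X(B_{g⁻¹})`.

Let `B` consist of the matrices over the functions `ℝ → k` of countable support, with one row and
column without restriction on the supports and one more for each countable `S ⊆ ℝ`, where the
supports lie in `S`. Give the position `(p, q)` the degree `d p * (d q)⁻¹`, where `d = g` for the
unrestricted row and `d = 1` for the others. For countable `S`, the unrestricted diagonal position
carries an idempotent `e_S`, the indicator function of `S`, which factors through the index `S`; so
`ψ (e_S)` is defined. Its entries in the unrestricted row have degree `g`, hence lie in columns
restricted to countable sets, and only finitely many are non-zero. By left linearity, restricting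
`ψ (e_S)` to a point `x ∈ S` gives `ψ (e_{x}) ≠ 0`. Every column contains only countably many `x`,
and `ℝ` is uncountable, so infinitely many columns occur in the various `ψ (e_{x})`. If `S` contains
points `x` for infinitely many columns, then `ψ (e_S)` has infinitely many non-zero entries, a
contradiction. -/

namespace TwistedPartial

namespace FMat

variable {X B : Type*} [NonUnitalRing B]

/-- The matrix with `(i, j)`-entry `b` and all other entries zero. -/
noncomputable def single (i j : X) (b : B) : FMat X B := Finsupp.single (i, j) b

open Classical in
theorem single_apply (i j p q : X) (b : B) :
    single i j b (p, q) = if p = i ∧ q = j then b else 0 := by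
  change Finsupp.single (i, j) b (p, q) = _
  rw [Finsupp.single_apply]
  simp only [Prod.mk.injEq, eq_comm]

theorem single_ne_zero {i j : X} {b : B} (hb : b ≠ 0) : single i j b ≠ 0 :=
  Finsupp.single_ne_zero.2 hb

open Classical in
theorem single_mul_apply (p q i j : X) (b : B) (M : FMat X B) :
    (single p q b * M) (i, j) = if i = p then b * M (q, j) else 0 := by
  rw [mul_apply, finsum_eq_single _ q fun l hl => by simp [single_apply, hl]]
  by_cases h : i = p <;> simp [single_apply, h]

open Classical in
theorem mul_single_apply (p q i j : X) (b : B) (M : FMat X B) :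
    (M * single p q b) (i, j) = if j = q then M (i, p) * b else 0 := by
  rw [mul_apply, finsum_eq_single _ p fun l hl => by simp [single_apply, hl]]
  by_cases h : j = q <;> simp [single_apply, h]

theorem single_mul_single (i j l : X) (a b : B) :
    single i j a * single j l b = single i l (a * b) := by
  classical
  ext p q
  rw [single_mul_apply, single_apply, single_apply]
  by_cases hp : p = i <;> by_cases hq : q = l <;> simp [hp, hq]

theorem exists_apply_ne_zero {M : FMat X B} (hM : M ≠ 0) : ∃ i j, M (i, j) ≠ 0 := by
  by_contra! h
  exact hM (ext h)

theorem exists_of_mul_apply_ne_zero {M N : FMat X B} {i j : X} (h : (M * N) (i, j) ≠ 0) :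
    ∃ l, M (i, l) ≠ 0 ∧ N (l, j) ≠ 0 := by
  obtain ⟨l, hl⟩ := exists_ne_zero h
  exact ⟨l, left_ne_zero_of_mul hl, right_ne_zero_of_mul hl⟩

theorem finite_setOf_apply_ne_zero (M : FMat X B) : {p : X × X | M p ≠ 0}.Finite :=
  Finsupp.hasFiniteSupport (M : (X × X) →₀ B)

theorem sum_apply {ι : Type*} (s : Finset ι) (f : ι → FMat X B) (p : X × X) :
    (∑ i ∈ s, f i) p = ∑ i ∈ s, f i p :=
  Finsupp.finsetSum_apply s f p

theorem sum_single (M : FMat X B) :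
    ∑ p ∈ Finsupp.support (M : (X × X) →₀ B), single p.1 p.2 (M p) = M :=
  Finsupp.sum_single (M : (X × X) →₀ B)

/-- The diagonal matrix with entries `a p` for `p ∈ F` and zero elsewhere. -/
noncomputable def diagonal (F : Finset X) (a : X → B) : FMat X B := ∑ p ∈ F, single p p (a p)

open Classical in
theorem diagonal_mul_apply (F : Finset X) (a : X → B) (M : FMat X B) (i j : X) :
    (diagonal F a * M) (i, j) = if i ∈ F then a i * M (i, j) else 0 := by
  rw [diagonal, Finset.sum_mul, sum_apply]
  simp only [single_mul_apply, Finset.sum_ite_eq]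

open Classical in
theorem mul_diagonal_apply (F : Finset X) (a : X → B) (M : FMat X B) (i j : X) :
    (M * diagonal F a) (i, j) = if j ∈ F then M (i, j) * a j else 0 := by
  rw [diagonal, Finset.mul_sum, sum_apply]
  simp only [mul_single_apply, Finset.sum_ite_eq]

theorem diagonal_apply_ne_zero {F : Finset X} {a : X → B} {i j : X}
    (h : diagonal F a (i, j) ≠ 0) : i = j ∧ i ∈ F ∧ diagonal F a (i, j) = a i := by
  classical
  rw [diagonal, sum_apply] at h ⊢
  obtain ⟨p, hpF, hp⟩ := Finset.exists_ne_zero_of_sum_ne_zero h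
  obtain ⟨rfl, rfl⟩ : i = p ∧ j = p := by
    by_contra hij
    exact hp (by rw [single_apply, if_neg hij])
  refine ⟨rfl, hpF, ?_⟩
  simp [single_apply, hpF]

section Module

variable {k : Type*} [CommRing k] [Module k B]

theorem single_mem_submodule {S : Submodule k B} (i j : X) {b : B} (hb : b ∈ S) :
    single i j b ∈ submodule X S := by
  classical
  intro p q
  rw [single_apply]
  split_ifs
  exacts [hb, S.zero_mem]

variable (k) in
/-- The matrices whose non-zero entries all lie in the positions `E`. -/
def supportedOn (E : Set (X × X)) : Submodule k (FMat X B) where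
  carrier := {M | ∀ p, M p ≠ 0 → p ∈ E}
  add_mem' {M N} hM hN p hp := by
    by_cases h : M p = 0
    · exact hN p fun h' => hp (by rw [add_apply, h, h', add_zero])
    · exact hM p h
  zero_mem' _ h := absurd rfl h
  smul_mem' c M hM p hp := hM p fun h => hp (by rw [smul_apply, h, smul_zero])

theorem single_mem_supportedOn {E : Set (X × X)} {i j : X} (h : (i, j) ∈ E) (b : B) :
    single i j b ∈ supportedOn k E := by
  classical
  rintro ⟨p, q⟩ hpq
  rw [single_apply] at hpq
  obtain ⟨rfl, rfl⟩ := (ite_ne_right_iff.1 hpq).1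
  exact h

theorem disjoint_supportedOn {E F : Set (X × X)} (h : Disjoint E F) :
    Disjoint (supportedOn k E : Submodule k (FMat X B)) (supportedOn k F) := by
  refine Submodule.disjoint_def.2 fun M hE hF => Finsupp.ext fun p => ?_
  by_contra hp
  exact Set.disjoint_left.1 h (hE p hp) (hF p hp)

end Module

end FMat

namespace TwistedPartialAction

variable {k G A : Type*} [CommRing k] [Group G] [NonUnitalRing A] [Module k A]
  [IsScalarTower k A A] [SMulCommClass k A A] (Θ : TwistedPartialAction k G A)

theorem mem_D_one (a : A) : a ∈ Θ.D 1 := by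
  rw [Θ.D_one]
  trivial

/-- The embedding `a ↦ a δ_1` of `A = D 1` into the crossed product. -/
noncomputable def δOne : A →ₗ[k] Θ.CrossedProduct where
  toFun a := Θ.δ 1 ⟨a, Θ.mem_D_one a⟩
  map_add' a b := map_add (Θ.δ 1) ⟨a, Θ.mem_D_one a⟩ ⟨b, Θ.mem_D_one b⟩
  map_smul' c a := map_smul (Θ.δ 1) c ⟨a, Θ.mem_D_one a⟩

theorem δ_injective (g : G) : Function.Injective (Θ.δ g) := by
  classical
  exact DirectSum.of_injective (β := fun g => ↥(Θ.D g)) g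

theorem δOne_injective : Function.Injective Θ.δOne := fun _ _ h =>
  congrArg Subtype.val (Θ.δ_injective 1 h)

theorem δ_congr {g h : G} (e : g = h) {x : Θ.D g} {y : Θ.D h} (hxy : (x : A) = y) :
    Θ.δ g x = Θ.δ h y := by
  subst e
  rw [Subtype.ext hxy]

theorem coeff_one_left {h : G} (a : Θ.D 1) (b : Θ.D h) : (Θ.coeff 1 h a b : A) = a * b := by
  have symm_apply : ((Θ.θ 1).symm a : A) = a := by
    rw [← Θ.θ_one, LinearEquiv.apply_symm_apply]
  have hab : (a : A) * b ∈ Θ.D (1 : G)⁻¹ * Θ.D h := symm_apply ▸ Θ.coeff_mem a b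
  rw [Θ.coeff_of_eq hab (by rw [symm_apply]), Θ.w_one_left]
  exact Θ.θ_one _

theorem δOne_mul_δ {h : G} (a : A) (b : Θ.D h) :
    Θ.δOne a * Θ.δ h b = Θ.δ h ⟨a * b, (Θ.D h).mul_mem_left a b.2⟩ :=
  (Θ.δ_mul_δ 1 h _ b).trans (Θ.δ_congr (one_mul h) (Θ.coeff_one_left _ b))

theorem δOne_mul_δOne (a b : A) : Θ.δOne a * Θ.δOne b = Θ.δOne (a * b) :=
  Θ.δOne_mul_δ a ⟨b, Θ.mem_D_one b⟩

theorem δ_mul_δ_inv_mem {g : G} (a : Θ.D g) (b : Θ.D g⁻¹) :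
    Θ.δ g a * Θ.δ g⁻¹ b ∈ (Θ.D g).toSubmodule.map Θ.δOne := by
  refine ⟨Θ.coeff g g⁻¹ a b, AlgIdeal.mem_left_of_mem_mul (SetLike.coe_mem
    ((Θ.w g g⁻¹).val.right (Θ.θres g g⁻¹ _ (Θ.coeff_mem a b)))), ?_⟩
  rw [δ_mul_δ]
  exact Θ.δ_congr (mul_inv_cancel g).symm rfl

section Isomorphism

variable {C : Type*} [NonUnitalRing C] [Module k C] {𝓒 : G → Submodule k C}

theorem apply_mem_map_δOne {e : C →ₗ[k] Θ.CrossedProduct} (he : ∀ x y, e (x * y) = e x * e y)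
    (hcomp : ∀ h, (𝓒 h).map e ≤ Θ.component h) {g : G} {r : C}
    (hr : r ∈ mulSub (𝓒 g) (𝓒 g⁻¹)) : e r ∈ (Θ.D g).toSubmodule.map Θ.δOne := by
  suffices h : mulSub (𝓒 g) (𝓒 g⁻¹) ≤ ((Θ.D g).toSubmodule.map Θ.δOne).comap e from h hr
  refine mulSub_le.2 fun x hx y hy => ?_
  obtain ⟨a, ha⟩ := hcomp g (Submodule.mem_map_of_mem hx)
  obtain ⟨b, hb⟩ := hcomp g⁻¹ (Submodule.mem_map_of_mem hy)
  rw [Submodule.mem_comap, he, ← ha, ← hb]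
  exact Θ.δ_mul_δ_inv_mem a b

/-- Under the isomorphism `C_g C_{g⁻¹}` lands in `D g δ_1`, and there `ψ` is `a δ_1 ↦ a δ_g`. -/
theorem exists_leftLinear_of_gradedIsomorphic (hΘ : GradedIsomorphic 𝓒 Θ.component) (g : G) :
    ∃ ψ : C → C, (∀ r ∈ mulSub (𝓒 g) (𝓒 g⁻¹), ψ r ∈ 𝓒 g) ∧
      (∀ r ∈ mulSub (𝓒 g) (𝓒 g⁻¹), ψ r = 0 → r = 0) ∧
      ∀ s ∈ 𝓒 1, ∀ r ∈ mulSub (𝓒 g) (𝓒 g⁻¹), s * r ∈ mulSub (𝓒 g) (𝓒 g⁻¹) →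
        ψ (s * r) = s * ψ r := by
  obtain ⟨e, he, hcomp⟩ := hΘ
  have exists_coeff : ∀ r ∈ mulSub (𝓒 g) (𝓒 g⁻¹), ∃ a : Θ.D g, Θ.δOne a = e r := fun r hr => by
    obtain ⟨a, ha, har⟩ := Θ.apply_mem_map_δOne (e := e) he (fun h => (hcomp h).le) hr
    exact ⟨⟨a, ha⟩, har⟩
  choose! coeff hcoeff using exists_coeff
  refine ⟨fun r => e.symm (Θ.δ g (coeff r)), fun r _ => ?_, fun r hr h => ?_,
    fun s hs r hr hsr => ?_⟩
  · obtain ⟨x, hx, hxr⟩ := (hcomp g).ge ⟨coeff r, rfl⟩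
    change e.symm (Θ.δ g (coeff r)) ∈ 𝓒 g
    rw [← hxr]
    simpa using hx
  · have hcoeff_zero : coeff r = 0 := Θ.δ_injective g (by simpa using h)
    have := hcoeff r hr
    rw [hcoeff_zero, ZeroMemClass.coe_zero, map_zero] at this
    simpa using this.symm
  · obtain ⟨b, hb⟩ := (hcomp 1).le (Submodule.mem_map_of_mem hs)
    replace hb : Θ.δOne b = e s := hb
    have coeff_mul : (coeff (s * r) : A) = b * coeff r := Θ.δOne_injective (by
      rw [hcoeff _ hsr, he, ← hb, ← hcoeff r hr, δOne_mul_δOne])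
    refine e.injective ?_
    rw [he, e.apply_symm_apply, e.apply_symm_apply, ← hb, δOne_mul_δ]
    exact Θ.δ_congr rfl coeff_mul

end Isomorphism

end TwistedPartialAction

namespace Grading

variable {k G B : Type*} [CommRing k] [Group G] [NonUnitalRing B] [Module k B]

theorem mulSub_component_le (𝓑 : Grading k G B) (g h : G) :
    mulSub (𝓑.component g) (𝓑.component h) ≤ 𝓑.component (g * h) :=
  mulSub_le.2 fun _ hx _ hy => 𝓑.mul_mem hx hy

end Grading

/-- Submodules `entry p q` of `A`, indexed by pairs, such that the matrices over `A` with
`(p, q)`-entry in `entry p q` are closed under multiplication. -/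
structure EntrySystem (k J A : Type*) [CommRing k] [NonUnitalRing A] [Module k A] where
  entry : J → J → Submodule k A
  mul_mem : ∀ {p q r a b}, a ∈ entry p q → b ∈ entry q r → a * b ∈ entry p r

namespace EntrySystem

variable {k J A : Type*} [CommRing k] [NonUnitalRing A] [Module k A] (I : EntrySystem k J A)

/-- The generalized matrix algebra of `I`: the matrices in `FMat J A` with `(p, q)`-entry in
`I.entry p q`. -/
noncomputable def matrixAlgebra : NonUnitalSubalgebra k (FMat J A) where
  carrier := {M | ∀ p q, M (p, q) ∈ I.entry p q}
  add_mem' hM hN p q := add_mem (hM p q) (hN p q)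
  zero_mem' p q := zero_mem (I.entry p q)
  smul_mem' c _ hM p q := Submodule.smul_mem _ c (hM p q)
  mul_mem' hM hN p q := finsum_induction (· ∈ I.entry p q) (zero_mem _)
    (fun _ _ => add_mem) fun l => I.mul_mem (hM p l) (hN l q)

variable {I}

variable (I) in
theorem apply_mem (M : I.matrixAlgebra) (p q : J) : M.1 (p, q) ∈ I.entry p q := M.2 p q

theorem exists_apply_ne_zero {M : I.matrixAlgebra} (hM : M ≠ 0) : ∃ p q, M.1 (p, q) ≠ 0 :=
  FMat.exists_apply_ne_zero fun h => hM (Subtype.ext h)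

theorem finite_setOf_row_ne_zero {X : Type*} (M : FMat X I.matrixAlgebra) (s : X) (o : J) :
    {i : X × J | (M (s, i.1)).1 (o, i.2) ≠ 0}.Finite := by
  have hM := FMat.finite_setOf_apply_ne_zero M
  have hcol : (⋃ z ∈ {z | M z ≠ 0}, Prod.snd '' {y | (M z).1 y ≠ 0}).Finite :=
    hM.biUnion fun z _ => (FMat.finite_setOf_apply_ne_zero (M z).1).image Prod.snd
  refine ((hM.image Prod.snd).prod hcol).subset fun i hi => ?_
  have hMi : (s, i.1) ∈ {z | M z ≠ 0} := fun h => hi (by rw [h]; rfl)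
  exact ⟨⟨_, hMi, rfl⟩, Set.mem_biUnion hMi ⟨_, hi, rfl⟩⟩

variable (I) in
/-- The matrix unit with `(p, q)`-entry `a`, as an element of the generalized matrix algebra. -/
noncomputable def single (p q : J) (a : I.entry p q) : I.matrixAlgebra :=
  ⟨FMat.single p q a, fun i j => by
    classical
    rw [FMat.single_apply]
    split_ifs with h
    · obtain ⟨rfl, rfl⟩ := h
      exact a.2
    · exact zero_mem _⟩

theorem single_mul_single {p q r : J} (a : I.entry p q) (b : I.entry q r) :
    I.single p q a * I.single q r b = I.single p r ⟨a * b, I.mul_mem a.2 b.2⟩ :=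
  Subtype.ext (FMat.single_mul_single p q r a.1 b.1)

theorem mem_of_single_mem {P : Submodule k I.matrixAlgebra} {M : I.matrixAlgebra}
    (h : ∀ p q, M.1 (p, q) ≠ 0 → I.single p q ⟨M.1 (p, q), I.apply_mem M p q⟩ ∈ P) : M ∈ P := by
  have sum_single : ∑ z ∈ Finsupp.support (M.1 : (J × J) →₀ A),
      I.single z.1 z.2 ⟨M.1 z, I.apply_mem M z.1 z.2⟩ = M := by
    refine Subtype.ext ?_
    rw [AddSubmonoidClass.coe_finsetSum]
    exact FMat.sum_single M.1
  rw [← sum_single]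
  exact sum_mem fun z hz => h z.1 z.2 (Finsupp.mem_support_iff.1 hz)

section Grading

variable {G : Type*} [Group G] {d : J → G}

variable (I d) in
/-- The matrices whose non-zero entries lie in positions `(p, q)` of degree
`d p * (d q)⁻¹ = h`. -/
noncomputable def component (h : G) : Submodule k I.matrixAlgebra :=
  (FMat.supportedOn k {z | d z.1 * (d z.2)⁻¹ = h}).comap I.matrixAlgebra.subtype

theorem single_mem_component {p q : J} {h : G} (hpq : d p * (d q)⁻¹ = h) (a : I.entry p q) :
    I.single p q a ∈ I.component d h :=
  FMat.single_mem_supportedOn (k := k) (E := {z | d z.1 * (d z.2)⁻¹ = h}) hpq a.1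

theorem mul_mem_component {g h : G} {M N : I.matrixAlgebra} (hM : M ∈ I.component d g)
    (hN : N ∈ I.component d h) : M * N ∈ I.component d (g * h) := by
  rintro ⟨p, q⟩ hpq
  obtain ⟨l, hl, hl'⟩ := FMat.exists_of_mul_apply_ne_zero hpq
  have hpl : d p * (d l)⁻¹ = g := hM _ hl
  have hlq : d l * (d q)⁻¹ = h := hN _ hl'
  change d p * (d q)⁻¹ = g * h
  rw [← hpl, ← hlq]
  group

theorem iSupIndep_component : iSupIndep (I.component d) := by
  refine iSupIndep_def.2 fun h => Submodule.disjoint_def.2 fun M hM hM' => Subtype.ext ?_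
  have iSup_le : ⨆ (j : G) (_ : j ≠ h), I.component d j ≤
      (FMat.supportedOn k {z | d z.1 * (d z.2)⁻¹ ≠ h}).comap I.matrixAlgebra.subtype :=
    iSup₂_le fun j hj N hN z hz hzh => hj ((hN z hz).symm.trans hzh)
  exact Submodule.disjoint_def.1 (FMat.disjoint_supportedOn (k := k) disjoint_compl_right) M.1 hM
    (iSup_le hM')

theorem iSup_component : ⨆ h, I.component d h = ⊤ :=
  eq_top_iff.2 fun _ _ => mem_of_single_mem fun _ _ _ =>
    Submodule.mem_iSup_of_mem _ (single_mem_component rfl _)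

variable (I d) in
/-- The grading of the generalized matrix algebra in which position `(p, q)` has degree
`d p * (d q)⁻¹`. -/
noncomputable def grading : Grading k G I.matrixAlgebra where
  component := I.component d
  isInternal := by
    classical
    exact DirectSum.isInternal_submodule_of_iSupIndep_of_iSup_eq_top iSupIndep_component
      iSup_component
  mul_mem := mul_mem_component

theorem homogeneouslyNondegenerate_grading
    (hright : ∀ p q, ∀ a ∈ I.entry p q, a ≠ 0 → ∃ b ∈ I.entry q p, a * b ≠ 0)
    (hleft : ∀ p q, ∀ a ∈ I.entry p q, a ≠ 0 → ∃ b ∈ I.entry q p, b * a ≠ 0) :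
    (I.grading d).HomogeneouslyNondegenerate := by
  classical
  intro h M hM hM0
  obtain ⟨p, q, hpq⟩ := exists_apply_ne_zero hM0
  have hdeg : d q * (d p)⁻¹ = h⁻¹ := by
    rw [← show d p * (d q)⁻¹ = h from hM _ hpq]
    group
  constructor
  · obtain ⟨b, hb, hMb⟩ := hright p q _ (I.apply_mem M p q) hpq
    refine ⟨_, single_mem_component hdeg ⟨b, hb⟩, fun h0 => hMb ?_⟩
    have := congrArg (fun N : I.matrixAlgebra => N.1 (p, p)) h0
    exact (FMat.mul_single_apply q p p p b M.1).trans (if_pos rfl) |>.symm.trans this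
  · obtain ⟨b, hb, hbM⟩ := hleft p q _ (I.apply_mem M p q) hpq
    refine ⟨_, single_mem_component hdeg ⟨b, hb⟩, fun h0 => hbM ?_⟩
    have := congrArg (fun N : I.matrixAlgebra => N.1 (q, q)) h0
    exact (FMat.single_mul_apply q p q q b M.1).trans (if_pos rfl) |>.symm.trans this

theorem mulSub_mulSub_component
    (hfactor : ∀ p q, ∀ a ∈ I.entry p q, ∃ b ∈ I.entry p q, ∃ b' ∈ I.entry q p, b * b' * a = a)
    (h : G) :
    mulSub (mulSub ((I.grading d).component h) ((I.grading d).component h⁻¹))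
      ((I.grading d).component h) = (I.grading d).component h := by
  refine le_antisymm (mulSub_le.2 fun x hx y hy => ?_) fun M hM =>
    mem_of_single_mem fun p q hpq => ?_
  · simpa using (I.grading d).mul_mem ((I.grading d).mulSub_component_le _ _ hx) hy
  · obtain ⟨b, hb, b', hb', hbb'⟩ := hfactor p q _ (I.apply_mem M p q)
    have hdeg : d p * (d q)⁻¹ = h := hM _ hpq
    have hdeg' : d q * (d p)⁻¹ = h⁻¹ := by
      rw [← hdeg]
      group
    have single_eq : I.single p q ⟨M.1 (p, q), I.apply_mem M p q⟩ =
        I.single p q ⟨b, hb⟩ * I.single q p ⟨b', hb'⟩ *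
          I.single p q ⟨M.1 (p, q), I.apply_mem M p q⟩ := by
      rw [single_mul_single, single_mul_single]
      exact congrArg _ (Subtype.ext hbb'.symm)
    rw [single_eq]
    exact mul_mem_mulSub (mul_mem_mulSub (single_mem_component hdeg _)
      (single_mem_component hdeg' _)) (single_mem_component hdeg _)

theorem mem_range_of_mem_dom {h : G} {M : I.matrixAlgebra} (hM : M ∈ (I.grading d).dom h)
    {p q : J} (hpq : M.1 (p, q) ≠ 0) : h⁻¹ * d p ∈ Set.range d ∧ h⁻¹ * d q ∈ Set.range d := by
  suffices hle : (I.grading d).dom h ≤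
      (FMat.supportedOn k {z | h⁻¹ * d z.1 ∈ Set.range d ∧ h⁻¹ * d z.2 ∈ Set.range d}).comap
        I.matrixAlgebra.subtype from hle hM (p, q) hpq
  refine mulSub_le.2 fun x hx y hy => ?_
  rintro ⟨i, j⟩ hij
  obtain ⟨l, hl, hl'⟩ := FMat.exists_of_mul_apply_ne_zero hij
  have hil : d i * (d l)⁻¹ = h := hx _ hl
  have hlj : d l * (d j)⁻¹ = h⁻¹ := hy _ hl'
  refine ⟨⟨l, ?_⟩, ⟨l, ?_⟩⟩
  · rw [← hil]
    group
  · rw [← hlj]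
    group

end Grading

end EntrySystem

/-- The countable subsets of `Ω`. -/
abbrev CountableSet (Ω : Type*) := {S : Set Ω // S.Countable}

/-- A one-point set as a countable set. -/
def CountableSet.singleton {Ω : Type*} (x : Ω) : CountableSet Ω :=
  ⟨{x}, Set.countable_singleton x⟩

section CountableSupport

variable (k : Type*) [CommRing k] {Ω : Type*}

/-- The functions `Ω → k` whose support is countable and contained in `T`. -/
def countablySupported (T : Set Ω) : Submodule k (Ω → k) where
  carrier := {f | f.support.Countable ∧ f.support ⊆ T}
  add_mem' hf hg :=
    ⟨(hf.1.union hg.1).mono (Function.support_add _ _),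
      (Function.support_add _ _).trans (Set.union_subset hf.2 hg.2)⟩
  zero_mem' := by simp
  smul_mem' c f hf :=
    ⟨hf.1.mono (Function.support_const_smul_subset c f),
      (Function.support_const_smul_subset c f).trans hf.2⟩

variable {k}

theorem mul_mem_countablySupported {S T : Set Ω} {f g : Ω → k} (hf : f ∈ countablySupported k S)
    (hg : g ∈ countablySupported k T) : f * g ∈ countablySupported k (S ∩ T) := by
  refine ⟨hf.1.mono ?_, ?_⟩
  all_goals rw [Pi.mul_def]
  · exact Function.support_mul_subset_left f g
  · exact Set.subset_inter ((Function.support_mul_subset_left f g).trans hf.2)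
      ((Function.support_mul_subset_right f g).trans hg.2)

theorem indicator_mem_countablySupported {S T : Set Ω} (hS : S.Countable) (hST : S ⊆ T)
    (f : Ω → k) : S.indicator f ∈ countablySupported k T :=
  ⟨hS.mono Set.support_indicator_subset, Set.support_indicator_subset.trans hST⟩

theorem exists_mul_eq_self_of_mem_countablySupported {T : Set Ω} {f : Ω → k}
    (hf : f ∈ countablySupported k T) : ∃ e ∈ countablySupported k T, e * f = f := by
  refine ⟨f.support.indicator 1, indicator_mem_countablySupported hf.1 hf.2 1, ?_⟩
  ext x
  by_cases hx : f x = 0 <;> simp [hx]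

variable (k) in
/-- The entry system attached to sets `c p ⊆ Ω`: the `(p, q)`-entries are the functions with
countable support in `c p ∩ c q`. -/
def countableSupportSystem {J : Type*} (c : J → Set Ω) : EntrySystem k J (Ω → k) where
  entry p q := countablySupported k (c p ∩ c q)
  mul_mem ha hb :=
    have hab := mul_mem_countablySupported ha hb
    ⟨hab.1, hab.2.trans fun _ hx => ⟨hx.1.1, hx.2.2⟩⟩

namespace countableSupportSystem

variable {J : Type*} {c : J → Set Ω}

theorem entry_comm (p q : J) :
    (countableSupportSystem k c).entry p q = (countableSupportSystem k c).entry q p :=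
  congrArg (countablySupported k) (Set.inter_comm _ _)

theorem homogeneouslyNondegenerate_grading {G : Type*} [Group G] (d : J → G) :
    ((countableSupportSystem k c).grading d).HomogeneouslyNondegenerate := by
  refine EntrySystem.homogeneouslyNondegenerate_grading (fun p q f hf hf0 => ?_)
    fun p q f hf hf0 => ?_
  all_goals
    obtain ⟨e, he, hef⟩ := exists_mul_eq_self_of_mem_countablySupported hf
    refine ⟨e, (entry_comm (k := k) (c := c) p q).le he, ?_⟩
  · rwa [mul_comm, hef]
  · rwa [hef]

theorem mulSub_mulSub_component {G : Type*} [Group G] (d : J → G) (h : G) :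
    mulSub (mulSub (((countableSupportSystem k c).grading d).component h)
        (((countableSupportSystem k c).grading d).component h⁻¹))
      (((countableSupportSystem k c).grading d).component h) =
        ((countableSupportSystem k c).grading d).component h := by
  refine EntrySystem.mulSub_mulSub_component (fun p q f hf => ?_) h
  obtain ⟨e, he, hef⟩ := exists_mul_eq_self_of_mem_countablySupported hf
  exact ⟨e, he, e, (entry_comm (k := k) (c := c) p q).le he, by rw [mul_assoc, hef, hef]⟩

variable (k c) in
/-- The matrix with `(p, q)`-entry the indicator function of `S ∩ c p ∩ c q`. -/
noncomputable def unit (p q : J) (S : CountableSet Ω) :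
    (countableSupportSystem k c).matrixAlgebra :=
  (countableSupportSystem k c).single p q ⟨(S.1 ∩ (c p ∩ c q)).indicator 1,
    indicator_mem_countablySupported (S.2.mono Set.inter_subset_left) Set.inter_subset_right 1⟩

theorem unit_mul_unit {p q r : J} {S T : CountableSet Ω} (hST : S.1 ⊆ T.1) (hq : S.1 ⊆ c q) :
    unit k c p q S * unit k c q r T = unit k c p r S := by
  refine (EntrySystem.single_mul_single _ _).trans (congrArg _ (Subtype.ext ?_))
  change (S.1 ∩ (c p ∩ c q)).indicator 1 * (T.1 ∩ (c q ∩ c r)).indicator 1 =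
    (S.1 ∩ (c p ∩ c r)).indicator (1 : Ω → k)
  rw [← Set.inter_indicator_one]
  congr 1
  grind

variable (k c) in
/-- The diagonal matrix with entries the indicator functions of `T ∩ c p` for `p ∈ F`. -/
noncomputable def localUnit (F : Finset J) (T : CountableSet Ω) :
    (countableSupportSystem k c).matrixAlgebra := ∑ p ∈ F, unit k c p p T

theorem coe_localUnit (F : Finset J) (T : CountableSet Ω) :
    (localUnit k c F T : FMat J (Ω → k)) =
      FMat.diagonal F fun p => (T.1 ∩ (c p ∩ c p)).indicator 1 := by
  rw [localUnit, AddSubmonoidClass.coe_finsetSum]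
  rfl

theorem localUnit_mul {F : Finset J} {T : CountableSet Ω}
    {M : (countableSupportSystem k c).matrixAlgebra}
    (hM : ∀ p q x, M.1 (p, q) x ≠ 0 → p ∈ F ∧ x ∈ T.1) : localUnit k c F T * M = M := by
  classical
  refine Subtype.ext (FMat.ext fun p q => ?_)
  rw [NonUnitalSubalgebra.coe_mul, coe_localUnit, FMat.diagonal_mul_apply]
  ext x
  by_cases hx : M.1 (p, q) x = 0
  · split_ifs <;> simp [hx]
  · obtain ⟨hp, hxT⟩ := hM p q x hx
    have hxp : x ∈ c p := ((EntrySystem.apply_mem _ M p q).2 hx).1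
    simp [hp, hxT, hxp]

theorem mul_localUnit {F : Finset J} {T : CountableSet Ω}
    {M : (countableSupportSystem k c).matrixAlgebra}
    (hM : ∀ p q x, M.1 (p, q) x ≠ 0 → q ∈ F ∧ x ∈ T.1) : M * localUnit k c F T = M := by
  classical
  refine Subtype.ext (FMat.ext fun p q => ?_)
  rw [NonUnitalSubalgebra.coe_mul, coe_localUnit, FMat.mul_diagonal_apply]
  ext x
  by_cases hx : M.1 (p, q) x = 0
  · split_ifs <;> simp [hx]
  · obtain ⟨hq, hxT⟩ := hM p q x hx
    have hxq : x ∈ c q := ((EntrySystem.apply_mem _ M p q).2 hx).2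
    simp [hq, hxT, hxq]

theorem localUnit_mul_self (F : Finset J) (T : CountableSet Ω) :
    localUnit k c F T * localUnit k c F T = localUnit k c F T := by
  refine localUnit_mul fun p q x hx => ?_
  rw [coe_localUnit] at hx
  have hpq : FMat.diagonal F (fun p => (T.1 ∩ (c p ∩ c p)).indicator 1) (p, q) ≠ (0 : Ω → k) :=
    fun h => hx (congrFun h x)
  obtain ⟨-, hp, heq⟩ := FMat.diagonal_apply_ne_zero hpq
  rw [heq] at hx
  exact ⟨hp, (Set.mem_of_indicator_ne_zero hx).1⟩

theorem unit_mem_component {G : Type*} [Group G] {d : J → G} {p q : J} {h : G}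
    (hpq : d p * (d q)⁻¹ = h) (S : CountableSet Ω) :
    unit k c p q S ∈ ((countableSupportSystem k c).grading d).component h :=
  EntrySystem.single_mem_component hpq _

theorem unit_mem_dom {G : Type*} [Group G] {d : J → G} {p l : J} {h : G}
    (hpl : d p * (d l)⁻¹ = h) {S : CountableSet Ω} (hS : S.1 ⊆ c l) :
    unit k c p p S ∈ ((countableSupportSystem k c).grading d).dom h := by
  rw [← unit_mul_unit subset_rfl hS]
  refine mul_mem_mulSub (unit_mem_component hpl S) (unit_mem_component ?_ S)
  rw [← hpl]
  group

theorem localUnit_mem_dom {G : Type*} [Group G] {d : J → G} {h : G} {F : Finset J}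
    {T : CountableSet Ω} (hF : ∀ p ∈ F, ∃ l, d p * (d l)⁻¹ = h ∧ T.1 ⊆ c l) :
    localUnit k c F T ∈ ((countableSupportSystem k c).grading d).dom h :=
  sum_mem fun p hp =>
    have ⟨_, hl, hT⟩ := hF p hp
    unit_mem_dom hl hT

theorem exists_countable_support (M : (countableSupportSystem k c).matrixAlgebra) :
    ∃ (F : Finset J) (T : CountableSet Ω),
      ∀ p q x, M.1 (p, q) x ≠ 0 → p ∈ F ∧ q ∈ F ∧ x ∈ T.1 := by
  classical
  have hfin := FMat.finite_setOf_apply_ne_zero M.1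
  have hT : (⋃ z ∈ {z | M.1 z ≠ 0}, (M.1 z).support).Countable :=
    hfin.countable.biUnion fun z _ => (EntrySystem.apply_mem _ M z.1 z.2).1
  refine ⟨hfin.toFinset.image Prod.fst ∪ hfin.toFinset.image Prod.snd, ⟨_, hT⟩,
    fun p q x hx => ?_⟩
  have hpq : (p, q) ∈ {z | M.1 z ≠ 0} := fun h => hx (congrFun h x)
  have hpq' := hfin.mem_toFinset.2 hpq
  exact ⟨Finset.mem_union_left _ (Finset.mem_image_of_mem Prod.fst hpq'),
    Finset.mem_union_right _ (Finset.mem_image_of_mem Prod.snd hpq'), Set.mem_biUnion hpq hx⟩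

theorem hasLocalUnits_dom {G : Type*} [Group G] {d : J → G}
    (hc : ∀ (l : J) (T : CountableSet Ω), ∃ l', d l' = d l ∧ T.1 ⊆ c l') (h : G) :
    HasLocalUnits (((countableSupportSystem k c).grading d).dom h) := by
  classical
  intro M hM
  obtain ⟨F, T, hFT⟩ := exists_countable_support M
  let F' := F.filter fun p => h⁻¹ * d p ∈ Set.range d
  have mem_range : ∀ {p q x}, M.1 (p, q) x ≠ 0 →
      h⁻¹ * d p ∈ Set.range d ∧ h⁻¹ * d q ∈ Set.range d := fun {_ _ x} hx =>
    EntrySystem.mem_range_of_mem_dom hM fun h0 => hx (congrFun h0 x)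
  have left_unit : localUnit k c F' T * M = M := localUnit_mul fun p q x hx =>
    ⟨Finset.mem_filter.2 ⟨(hFT p q x hx).1, (mem_range hx).1⟩, (hFT p q x hx).2.2⟩
  have right_unit : M * localUnit k c F' T = M := mul_localUnit fun p q x hx =>
    ⟨Finset.mem_filter.2 ⟨(hFT p q x hx).2.1, (mem_range hx).2⟩, (hFT p q x hx).2.2⟩
  refine ⟨localUnit k c F' T, localUnit_mem_dom fun p hp => ?_, localUnit_mul_self F' T, M, hM,
    by rw [left_unit, right_unit]⟩
  obtain ⟨l, hl⟩ := (Finset.mem_filter.1 hp).2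
  obtain ⟨l', hl', hT⟩ := hc l T
  exact ⟨l', by rw [hl', hl]; group, hT⟩

end countableSupportSystem

end CountableSupport

theorem exists_infinite_setOf_ne_zero {k Ω ι : Type*} [Zero k] {s : Set Ω}
    (hs : ¬ s.Countable) {c : ι → Set Ω} (hc : ∀ i, (c i).Countable)
    {w : CountableSet Ω → ι → Ω → k} (hwc : ∀ S i, (w S i).support ⊆ c i)
    (hw : ∀ S : CountableSet Ω, S.1 ⊆ s → ∀ x ∈ S.1, ∀ i,
      w (.singleton x) i = ({x} : Set Ω).indicator (w S i))
    (hw0 : ∀ x ∈ s, ∃ i, w (.singleton x) i ≠ 0) :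
    ∃ S : CountableSet Ω, S.1 ⊆ s ∧ {i | w S i ≠ 0}.Infinite := by
  let K : Set ι := {i | ∃ x ∈ s, w (.singleton x) i ≠ 0}
  have mem_of_ne_zero : ∀ {x i}, x ∈ s → w (.singleton x) i ≠ 0 → x ∈ c i := by
    intro x i hx hxi
    obtain ⟨y, hy⟩ := Function.ne_iff.1 hxi
    have hyx : y ∈ ({x} : Set Ω) := by
      rw [hw (.singleton x) (Set.singleton_subset_iff.2 hx) x rfl i] at hy
      exact Set.mem_of_indicator_ne_zero hy
    exact Set.mem_singleton_iff.1 hyx ▸ hwc _ i hy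
  have infinite_K : K.Infinite := fun hK =>
    hs ((hK.countable.biUnion fun i _ => hc i).mono fun x hx => by
      obtain ⟨i, hi⟩ := hw0 x hx
      exact Set.mem_biUnion ⟨x, hx, hi⟩ (mem_of_ne_zero hx hi))
  obtain ⟨K', hK'K, hK', hK'inf⟩ := infinite_K.exists_subset_countable_infinite
  choose x hxs hx using fun i : K' => hK'K i.2
  have := hK'.to_subtype
  let S : CountableSet Ω := ⟨Set.range x, Set.countable_range x⟩
  have hS : S.1 ⊆ s := Set.range_subset_iff.2 hxs
  refine ⟨S, hS, hK'inf.mono fun i hi h0 => hx ⟨i, hi⟩ ?_⟩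
  rw [hw S hS _ ⟨⟨i, hi⟩, rfl⟩, h0]
  exact Set.indicator_zero _ _

namespace countableSupportSystem

variable {k Ω J X : Type*} [CommRing k] {c : J → Set Ω}

variable (k c) in
/-- The matrix over the generalized matrix algebra whose `(s, s)`-entry is
`unit k c o o S` and whose other entries are zero. -/
noncomputable def corner (s : X) (o : J) (S : CountableSet Ω) :
    FMat X (countableSupportSystem k c).matrixAlgebra :=
  FMat.single s s (unit k c o o S)

theorem corner_mul_corner {s : X} {o : J} {S T : CountableSet Ω} (hST : S.1 ⊆ T.1)
    (hS : S.1 ⊆ c o) : corner k c s o S * corner k c s o T = corner k c s o S :=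
  (FMat.single_mul_single s s s _ _).trans (congrArg _ (unit_mul_unit hST hS))

open Classical in
theorem corner_mul_apply (s : X) (o : J) (S : CountableSet Ω)
    (M : FMat X (countableSupportSystem k c).matrixAlgebra) (t u : X) (p q : J) :
    ((corner k c s o S * M) (t, u)).1 (p, q) =
      if t = s ∧ p = o then (S.1 ∩ c o).indicator ((M (s, u)).1 (o, q)) else 0 := by
  rw [corner, FMat.single_mul_apply]
  by_cases ht : t = s
  · rw [if_pos ht, NonUnitalSubalgebra.coe_mul]
    refine (FMat.single_mul_apply o o p q _ _).trans ?_
    by_cases hp : p = o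
    · rw [if_pos hp, if_pos ⟨ht, hp⟩]
      ext x
      simp [Set.indicator_apply]
    · rw [if_neg hp, if_neg fun h => hp h.2]
  · rw [if_neg ht, if_neg fun h => ht h.1]
    rfl

theorem corner_singleton_ne_zero [Nontrivial k] (s : X) {o : J} {x : Ω} (hx : x ∈ c o) :
    corner k c s o (.singleton x) ≠ 0 := by
  have indicator_ne_zero : (({x} : Set Ω) ∩ (c o ∩ c o)).indicator (1 : Ω → k) ≠ 0 :=
    Function.ne_iff.2 ⟨x, by simp [hx]⟩
  exact FMat.single_ne_zero fun h => FMat.single_ne_zero indicator_ne_zero (congrArg Subtype.val h)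

variable {G : Type*} [Group G] {d : J → G}

theorem corner_mem_submodule_one (s : X) (o : J) (S : CountableSet Ω) :
    corner k c s o S ∈
      FMat.submodule X (((countableSupportSystem k c).grading d).component 1) :=
  FMat.single_mem_submodule s s (unit_mem_component (mul_inv_cancel _) S)

theorem corner_mem_mulSub (s : X) {o l : J} {g : G} (hg : d o * (d l)⁻¹ = g) {S : CountableSet Ω}
    (hS : S.1 ⊆ c l) :
    corner k c s o S ∈
      mulSub (FMat.submodule X (((countableSupportSystem k c).grading d).component g))
        (FMat.submodule X (((countableSupportSystem k c).grading d).component g⁻¹)) := by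
  have hg' : d l * (d o)⁻¹ = g⁻¹ := by
    rw [← hg]
    group
  rw [corner, ← unit_mul_unit subset_rfl hS, ← FMat.single_mul_single s s s]
  exact mul_mem_mulSub (FMat.single_mem_submodule s s (unit_mem_component hg S))
    (FMat.single_mem_submodule s s (unit_mem_component hg' S))

theorem exists_eq_zero_of_corner_mul {g : G} {s : X} {o : J} (ho : ¬ (c o).Countable)
    (hcount : ∀ q, d o * (d q)⁻¹ = g → (c q).Countable)
    {φ : CountableSet Ω → FMat X (countableSupportSystem k c).matrixAlgebra}
    (hφ : ∀ S : CountableSet Ω, S.1 ⊆ c o →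
      φ S ∈ FMat.submodule X (((countableSupportSystem k c).grading d).component g))
    (hmul : ∀ S : CountableSet Ω, S.1 ⊆ c o → ∀ x ∈ S.1,
      corner k c s o (.singleton x) * φ S = φ (.singleton x)) :
    ∃ x ∈ c o, φ (.singleton x) = 0 := by
  by_contra! hφ0
  let w (S : CountableSet Ω) (i : X × {q // d o * (d q)⁻¹ = g}) : Ω → k :=
    (φ S (s, i.1)).1 (o, i.2)
  have support_w : ∀ S i, (w S i).support ⊆ c i.2 := fun S i =>
    (EntrySystem.apply_mem _ (φ S (s, i.1)) o i.2).2.trans Set.inter_subset_right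
  have w_singleton : ∀ S : CountableSet Ω, S.1 ⊆ c o → ∀ x ∈ S.1, ∀ i,
      w (.singleton x) i = ({x} : Set Ω).indicator (w S i) := by
    intro S hS x hx i
    have hxo : ({x} : Set Ω) ∩ c o = {x} :=
      Set.inter_eq_left.2 (Set.singleton_subset_iff.2 (hS hx))
    change (φ (.singleton x) (s, i.1)).1 (o, i.2) = _
    rw [← hmul S hS x hx, corner_mul_apply, if_pos ⟨rfl, rfl⟩]
    exact congrArg (Set.indicator · _) hxo
  have w_ne_zero : ∀ x ∈ c o, ∃ i, w (.singleton x) i ≠ 0 := by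
    intro x hx
    have hxo : (CountableSet.singleton x).1 ⊆ c o := Set.singleton_subset_iff.2 hx
    obtain ⟨t, u, htu⟩ := FMat.exists_apply_ne_zero (hφ0 x hx)
    obtain ⟨p, q, hpq⟩ := EntrySystem.exists_apply_ne_zero htu
    obtain ⟨rfl, rfl⟩ : t = s ∧ p = o := by
      by_contra h
      refine hpq ?_
      rw [← hmul _ hxo x rfl, corner_mul_apply, if_neg h]
    exact ⟨(u, ⟨q, hφ _ hxo t u _ hpq⟩), hpq⟩
  obtain ⟨S, -, hinf⟩ := exists_infinite_setOf_ne_zero ho (fun i => hcount i.2 i.2.2) support_w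
    w_singleton w_ne_zero
  refine hinf ((EntrySystem.finite_setOf_row_ne_zero (φ S) s o).preimage
    (f := Prod.map id Subtype.val) ?_)
  exact (Function.injective_id.prodMap Subtype.val_injective).injOn

theorem not_gradedIsomorphic [Nontrivial k] [Nonempty X] {A : Type*} [NonUnitalRing A] [Module k A]
    [IsScalarTower k A A] [SMulCommClass k A A] (Θ : TwistedPartialAction k G A) {g : G} {o : J}
    (ho : ¬ (c o).Countable)
    (hcover : ∀ S : CountableSet Ω, S.1 ⊆ c o → ∃ l, d o * (d l)⁻¹ = g ∧ S.1 ⊆ c l)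
    (hcount : ∀ q, d o * (d q)⁻¹ = g → (c q).Countable) :
    ¬ GradedIsomorphic
      (fun h => FMat.submodule X (((countableSupportSystem k c).grading d).component h))
      Θ.component := by
  intro hΘ
  obtain ⟨ψ, ψ_mem, ψ_eq_zero, ψ_mul⟩ := Θ.exists_leftLinear_of_gradedIsomorphic hΘ g
  obtain ⟨s⟩ := ‹Nonempty X›
  have corner_mem : ∀ S : CountableSet Ω, S.1 ⊆ c o → corner k c s o S ∈
      mulSub (FMat.submodule X (((countableSupportSystem k c).grading d).component g))
        (FMat.submodule X (((countableSupportSystem k c).grading d).component g⁻¹)) :=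
    fun S hS =>
      have ⟨_, hl, hSl⟩ := hcover S hS
      corner_mem_mulSub s hl hSl
  obtain ⟨x, hx, hx0⟩ := exists_eq_zero_of_corner_mul (φ := fun S => ψ (corner k c s o S)) ho
    hcount (fun S hS => ψ_mem _ (corner_mem S hS)) fun S hS x hx => by
      have hxo := Set.singleton_subset_iff.2 (hS hx)
      have mul_eq : corner k c s o (.singleton x) * corner k c s o S =
          corner k c s o (.singleton x) :=
        corner_mul_corner (Set.singleton_subset_iff.2 hx) hxo
      rw [← ψ_mul _ (corner_mem_submodule_one s o _) _ (corner_mem S hS)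
        (by rw [mul_eq]; exact corner_mem _ hxo), mul_eq]
  exact corner_singleton_ne_zero s hx
    (ψ_eq_zero _ (corner_mem _ (Set.singleton_subset_iff.2 hx)) hx0)

end countableSupportSystem

/-- The supports allowed in the rows of the counterexample: all of `Ω` in row `none`, and the
countable set `S` in row `some S`. -/
def rowSupport (Ω : Type*) : Option (CountableSet Ω) → Set Ω
  | none => Set.univ
  | some S => S.1

/-- The degrees of the rows of the counterexample: the row `none` is shifted by `g`. -/
def rowDegree (Ω : Type*) {G : Type*} [One G] (g : G) : Option (CountableSet Ω) → G
  | none => g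
  | some _ => 1

theorem exists_rowDegree_eq_of_countable {Ω G : Type*} [One G] (g : G)
    (l : Option (CountableSet Ω)) (T : CountableSet Ω) :
    ∃ l', rowDegree Ω g l' = rowDegree Ω g l ∧ T.1 ⊆ rowSupport Ω l' :=
  match l with
  | none => ⟨none, rfl, Set.subset_univ _⟩
  | some _ => ⟨some T, rfl, subset_rfl⟩

theorem rowSupport_countable {Ω G : Type*} [Group G] {g : G} (hg : g ≠ 1) :
    ∀ q, rowDegree Ω g none * (rowDegree Ω g q)⁻¹ = g → (rowSupport Ω q).Countable
  | none, h => absurd ((mul_inv_cancel g).symm.trans h).symm hg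
  | some S, _ => S.2

end TwistedPartial

open TwistedPartial TwistedPartial.countableSupportSystem in
theorem mainTheorem10_general {k : Type w} [CommRing k] [Nontrivial k] {G : Type u} [Group G]
    [Nontrivial G] :
    ∃ (B : Type w) (_ : NonUnitalRing B) (_ : Module k B) (_ : IsScalarTower k B B)
      (_ : SMulCommClass k B B) (𝓑 : Grading k G B),
      𝓑.HomogeneouslyNondegenerate ∧
      (∀ h : G, mulSub (mulSub (𝓑.component h) (𝓑.component h⁻¹)) (𝓑.component h) =
        𝓑.component h) ∧
      (∀ h : G, HasLocalUnits (𝓑.dom h)) ∧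
      ∀ (X : Type v) [Nonempty X] (A : Type*) [NonUnitalRing A] [Module k A]
        [IsScalarTower k A A] [SMulCommClass k A A] (Θ : TwistedPartialAction k G A),
        ¬ GradedIsomorphic (fun h => FMat.submodule X (𝓑.component h)) Θ.component := by
  obtain ⟨g, hg⟩ := exists_ne (1 : G)
  have not_countable : ¬ (rowSupport ℝ none).Countable := Cardinal.not_countable_real
  refine ⟨(countableSupportSystem k (rowSupport ℝ)).matrixAlgebra, inferInstance,
    inferInstance, inferInstance, inferInstance,
    (countableSupportSystem k (rowSupport ℝ)).grading (rowDegree ℝ g),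
    homogeneouslyNondegenerate_grading _, mulSub_mulSub_component _,
    hasLocalUnits_dom (exists_rowDegree_eq_of_countable g), fun X _ A _ _ _ _ Θ => ?_⟩
  exact not_gradedIsomorphic Θ not_countable
    (fun S _ => ⟨some S, by simp [rowDegree], subset_rfl⟩) (rowSupport_countable hg)

theorem mainTheorem10 {k : Type w} [CommRing k] [Nontrivial k] {G : Type u} [Group G]
    (g : G) (hg : g ^ 2 ≠ 1) :
    ∃ (B : Type w) (_ : NonUnitalRing B) (_ : Module k B) (_ : IsScalarTower k B B)
      (_ : SMulCommClass k B B) (𝓑 : TwistedPartial.Grading k G B),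
      𝓑.HomogeneouslyNondegenerate ∧
      (∀ h : G, TwistedPartial.mulSub
        (TwistedPartial.mulSub (𝓑.component h) (𝓑.component h⁻¹)) (𝓑.component h) =
          𝓑.component h) ∧
      (∀ h : G, TwistedPartial.HasLocalUnits (𝓑.dom h)) ∧
      ∀ (X : Type v) [Nonempty X]
        (Θ : TwistedPartial.TwistedPartialAction k G (TwistedPartial.FMat X 𝓑.unitComponent)),
        ¬ TwistedPartial.GradedIsomorphic
          (fun h => TwistedPartial.FMat.submodule X (𝓑.component h)) Θ.component := by
  have : Nontrivial G := ⟨g, 1, fun h => hg (by rw [h, one_pow])⟩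
  obtain ⟨B, i₁, i₂, i₃, i₄, 𝓑, hnondeg, hidem, hunits, hiso⟩ :=
    mainTheorem10_general (k := k) (G := G)
  exact ⟨B, i₁, i₂, i₃, i₄, 𝓑, hnondeg, hidem, hunits, fun X _ Θ => hiso X _ Θ⟩
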